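/- Let $I$ be an instance of the stable marriage problem with incomplete lists: finite sets $U$ of men and $W$ of women, each agent strictly ranking a subset of the other side in a preference list. A matching is a set of mutually acceptable pairs in which nobody occurs twice. It is stable if there is no mutually acceptable pair $(m,w)$ such that each of $m$, $w$ is unassigned or strictly prefers the other to his or her partner. Assume that every agent is assigned in some stable matching of $I$ (that is, agents unassigned in the stable matchings have been removed), and let $n=|U|=|W|$. Let $M_0$ be the man-optimal stable matching, in which every man has the best partner that he has in any stable matching. *Profiles.* For a set $M$ of pairs, $p(M)=\langle p_1,\dots,p_n\rangle$, where $p_k$ is the number of $(m,w)\in M$ with $w$ in position $k$ of $m$'s list plus the number of $(m,w)\in M$ with $m$ in position $k$ of $w$'s list. Vectors in $\mathbb Z^n$ are added entrywise and compared lexicographically. A stable matching $M$ is *rank-maximal* if $p(M)$ is lexicographically maximum among the profiles of all stable matchings, and *generous* if the reverse profile $\langle p_n,\dots,p_1\rangle$ is lexicographically minimum among the reverse profiles of all stable matchings. *Rotations.* A cyclically ordered list $\rho=(m_1,w_1),\dots,(m_r,w_r)$ of $r\ge 2$ distinct pairs of a stable matching $M$ is a *rotation exposed in $M$* if for every $i$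 (indices modulo $r$) $w_{i+1}$ is the first woman after $w_i$ on $m_i$'s list who prefers $m_i$ to her partner in $M$. *Eliminating* $\rho$ from $M$ replaces the pairs $(m_i,w_i)$ by the pairs $(m_i,w_{i+1})$. The rotations of $I$ are those exposed in some stable matching. The profile $p(\rho)$ is the net change $p(M')-p(M)$ of the profile when $\rho$ is eliminated from $M$, giving $M'$ (it does not depend on $M$), and the profile of a set of rotations is the sum of the profiles of its members. The *reversed, negated* profile of $\rho$ is $\langle -p_n,\dots,-p_1\rangle$ if $p(\rho)=\langle p_1,\dots,p_n\rangle$. In the rotation poset, $\pi$ precedes $\rho$ if in every sequence of successive eliminations of exposed rotations that starts from $M_0$ and leads to a matching in which $\rho$ is exposed, $\pi$ has been eliminated. A set of rotations is *closed* if it contains all predecessors of its members. Then: 1. A closed set of rotations whose profile is lexicographically maximum among all closed sets exists. For every such set $S$, the rotations of $S$ can be eliminated successively from $M_0$, each exactly once and each being exposed when it is eliminated; the resulting matching $M$ is the same for every such order, and $M$ is a rank-maximal stable matching. 2. A closed set of rotations for which the sum of the reversed, negated rotation profiles is lexicographically maximum among all closed sets exists. For every such set $S$, the rotations of $S$ can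 be eliminated successively from $M_0$, each exactly once and each being exposed when it is eliminated; the resulting matching $M$ is the same for every such order, and $M$ is a generous stable matching. -/

import Mathlib

/-- An instance of the stable marriage problem with incomplete lists, with men `U` and women `W`.
Every agent ranks, strictly and in decreasing order of preference, a subset of the other side. -/
structure SMI (U W : Type*) where
  manList : U → List W
  womanList : W → List U
  manList_nodup : ∀ m, (manList m).Nodup
  womanList_nodup : ∀ w, (womanList w).Nodup

namespace SMI

variable {U W : Type*} [Fintype U] [Fintype W] [DecidableEq U] [DecidableEq W]

/-- The position (counted from 1) of the woman `w` on the list of the man `m`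
(meaningful if `w` is on this list). -/
def manRank (I : SMI U W) (m : U) (w : W) : ℕ := (I.manList m).idxOf w + 1

/-- The position (counted from 1) of the man `m` on the list of the woman `w`
(meaningful if `m` is on this list). -/
def womanRank (I : SMI U W) (w : W) (m : U) : ℕ := (I.womanList w).idxOf m + 1

/-- `m` and `w` find each other acceptable. -/
def Acceptable (I : SMI U W) (m : U) (w : W) : Prop := w ∈ I.manList m ∧ m ∈ I.womanList w

/-- A matching: a set of acceptable pairs in which nobody occurs twice. -/
def IsMatching (I : SMI U W) (M : Finset (U × W)) : Prop :=
  (∀ p ∈ M, I.Acceptable p.1 p.2) ∧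
  (∀ m w w', (m, w) ∈ M → (m, w') ∈ M → w = w') ∧
  (∀ m m' w, (m, w) ∈ M → (m', w) ∈ M → m = m')

/-- The man `m` would rather be assigned to `w` than to his partner in `M` (if any). -/
def ManPrefers (I : SMI U W) (M : Finset (U × W)) (m : U) (w : W) : Prop :=
  w ∈ I.manList m ∧ ∀ w', (m, w') ∈ M → I.manRank m w < I.manRank m w'

/-- The woman `w` would rather be assigned to `m` than to her partner in `M` (if any). -/
def WomanPrefers (I : SMI U W) (M : Finset (U × W)) (w : W) (m : U) : Prop :=
  m ∈ I.womanList w ∧ ∀ m', (m', w) ∈ M → I.womanRank w m < I.womanRank w m'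

/-- A stable matching: a matching without a blocking pair. -/
def IsStable (I : SMI U W) (M : Finset (U × W)) : Prop :=
  I.IsMatching M ∧ ∀ m w, ¬ (I.ManPrefers M m w ∧ I.WomanPrefers M w m)

/-- The stable matching in which every man has the best partner that he has in any
stable matching. -/
def IsManOptimal (I : SMI U W) (M₀ : Finset (U × W)) : Prop :=
  I.IsStable M₀ ∧ ∀ M, I.IsStable M → ∀ m w, (m, w) ∈ M →
    ∃ w₀, (m, w₀) ∈ M₀ ∧ I.manRank m w₀ ≤ I.manRank m w

/-- Agents that are unassigned in the stable matchings have been removed: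
every agent is assigned in some stable matching. -/
def Preprocessed (I : SMI U W) : Prop :=
  (∀ m, ∃ M, I.IsStable M ∧ ∃ w, (m, w) ∈ M) ∧
  (∀ w, ∃ M, I.IsStable M ∧ ∃ m, (m, w) ∈ M)

/-- The profile of a set of pairs, a vector of length `n`, the number of men.
The entry with index `k : Fin n` counts the agents that have their `(k+1)`-st choice. -/
def profile (I : SMI U W) (M : Finset (U × W)) : Fin (Fintype.card U) → ℤ := fun k =>
  ((M.filter fun p => I.manRank p.1 p.2 = k + 1).card : ℤ) +
  ((M.filter fun p => I.womanRank p.2 p.1 = k + 1).card : ℤ)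

/-- The reverse of a vector. -/
def reverse {n : ℕ} (p : Fin n → ℤ) : Fin n → ℤ := fun k => p k.rev

/-- A stable matching whose profile is lexicographically maximum among all stable matchings. -/
def IsRankMaximal (I : SMI U W) (M : Finset (U × W)) : Prop :=
  I.IsStable M ∧ ∀ M', I.IsStable M' → toLex (I.profile M') ≤ toLex (I.profile M)

/-- A stable matching whose reverse profile is lexicographically minimum among all stable
matchings. -/
def IsGenerous (I : SMI U W) (M : Finset (U × W)) : Prop :=
  I.IsStable M ∧
    ∀ M', I.IsStable M' → toLex (reverse (I.profile M)) ≤ toLex (reverse (I.profile M'))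

/-- `w` is the first woman after the `M`-partner of `m` on the list of `m` who would rather be
assigned to `m` than to her partner in `M`. -/
def IsSucc (I : SMI U W) (M : Finset (U × W)) (m : U) (w : W) : Prop :=
  ∃ w₀, (m, w₀) ∈ M ∧
    (w ∈ I.manList m ∧ I.manRank m w₀ < I.manRank m w ∧ I.WomanPrefers M w m) ∧
    ∀ w', w' ∈ I.manList m → I.manRank m w₀ < I.manRank m w' → I.WomanPrefers M w' m →
      I.manRank m w ≤ I.manRank m w'

/-- A cyclically ordered list `(m₁, w₁), …, (mᵣ, wᵣ)` of pairs is encoded as the cyclic permutation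
`ρ` of `U × W` with `ρ (mᵢ, wᵢ) = (mᵢ₊₁, wᵢ₊₁)`; its support is the set of the pairs of the list.
It is exposed in `M` if its pairs are in `M` and, for each `i`, `wᵢ₊₁` is the first woman
after `wᵢ` on the list of `mᵢ` who prefers `mᵢ` to her partner in `M`. -/
def IsExposed (I : SMI U W) (M : Finset (U × W)) (ρ : Equiv.Perm (U × W)) : Prop :=
  ρ.IsCycle ∧ ρ.support ⊆ M ∧ ∀ p ∈ ρ.support, I.IsSucc M p.1 (ρ p).2

/-- The rotations of `I`: those exposed in some stable matching. -/
def Rotation (I : SMI U W) : Type _ :=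
  {ρ : Equiv.Perm (U × W) // ∃ M, I.IsStable M ∧ I.IsExposed M ρ}

/-- The pairs `(mᵢ, wᵢ₊₁)` created by eliminating the rotation. -/
def newPairs (ρ : Equiv.Perm (U × W)) : Finset (U × W) :=
  ρ.support.image fun p => (p.1, (ρ p).2)

/-- Eliminating a rotation from `M`: each man `mᵢ` moves from `wᵢ` to `wᵢ₊₁`. -/
def eliminate (M : Finset (U × W)) (ρ : Equiv.Perm (U × W)) : Finset (U × W) :=
  (M \ ρ.support) ∪ newPairs ρ

/-- The profile of a rotation: the profile of the pairs it creates minus the profile of the pairs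
it removes. By `profile_eliminate` this is the net change in profile when the rotation is
eliminated from any stable matching in which it is exposed. -/
def rotationProfile (I : SMI U W) (ρ : Equiv.Perm (U × W)) : Fin (Fintype.card U) → ℤ :=
  I.profile (newPairs ρ) - I.profile ρ.support

theorem profile_union (I : SMI U W) {A B : Finset (U × W)} (h : Disjoint A B) :
    I.profile (A ∪ B) = I.profile A + I.profile B := by
  funext k
  simp only [profile, Pi.add_apply, Finset.filter_union]
  rw [Finset.card_union_of_disjoint (Finset.disjoint_filter_filter h),
    Finset.card_union_of_disjoint (Finset.disjoint_filter_filter h)]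
  push_cast
  ring

theorem profile_eliminate (I : SMI U W) {M : Finset (U × W)} (hM : I.IsStable M)
    {ρ : Equiv.Perm (U × W)} (hρ : I.IsExposed M ρ) :
    I.rotationProfile ρ = I.profile (eliminate M ρ) - I.profile M := by
  obtain ⟨-, hs, hsucc⟩ := hρ
  have hd : Disjoint (M \ ρ.support) (newPairs ρ) := by
    rw [Finset.disjoint_left]
    intro x hx hx'
    obtain ⟨p, hp, rfl⟩ := Finset.mem_image.1 hx'
    obtain ⟨w₀, hw₀, ⟨-, hlt, -⟩, -⟩ := hsucc p hp
    have := hM.1.2.1 _ _ _ hw₀ (Finset.mem_sdiff.1 hx).1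
    rw [this] at hlt
    exact lt_irrefl _ hlt
  have h1 : I.profile M = I.profile (M \ ρ.support) + I.profile ρ.support := by
    rw [← I.profile_union Finset.sdiff_disjoint, Finset.sdiff_union_of_subset hs]
  rw [rotationProfile, eliminate, I.profile_union hd, h1]
  abel

/-- `EliminationSeq I M L M'`: the rotations in the list `L` can be eliminated successively,
each one being exposed when it is eliminated, starting from `M` and ending in `M'`. -/
inductive EliminationSeq (I : SMI U W) :
    Finset (U × W) → List I.Rotation → Finset (U × W) → Prop
  | nil (M : Finset (U × W)) : EliminationSeq I M [] M
  | cons {M M' : Finset (U × W)} {ρ : I.Rotation} {L : List I.Rotation}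
      (hρ : I.IsExposed M ρ.1) (h : EliminationSeq I (eliminate M ρ.1) L M') :
      EliminationSeq I M (ρ :: L) M'

/-- The strict order of the rotation poset: `π` precedes `ρ` if, starting from the man-optimal
stable matching `M₀`, the rotation `ρ` is not exposed until `π` has been eliminated. -/
def Precedes (I : SMI U W) (M₀ : Finset (U × W)) (π ρ : I.Rotation) : Prop :=
  ∀ L M, I.EliminationSeq M₀ L M → I.IsExposed M ρ.1 → π ∈ L

/-- A closed subset of the rotation poset: it contains all predecessors of its elements. -/
def IsClosedSubset (I : SMI U W) (M₀ : Finset (U × W)) (S : Finset I.Rotation) : Prop :=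
  ∀ ρ ∈ S, ∀ π, I.Precedes M₀ π ρ → π ∈ S

/-- The profile of a set of rotations. -/
def setProfile (I : SMI U W) (S : Finset I.Rotation) : Fin (Fintype.card U) → ℤ :=
  ∑ ρ ∈ S, I.rotationProfile ρ.1

/-- The profile of a set of rotations whose profiles are reversed and negated. -/
def setRevNegProfile (I : SMI U W) (S : Finset I.Rotation) : Fin (Fintype.card U) → ℤ :=
  ∑ ρ ∈ S, -reverse (I.rotationProfile ρ.1)

/-- A closed subset of lexicographically maximum profile among all closed subsets. -/
def IsMaxProfileClosedSubset (I : SMI U W) (M₀ : Finset (U × W)) (S : Finset I.Rotation) : Prop :=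
  I.IsClosedSubset M₀ S ∧
    ∀ S', I.IsClosedSubset M₀ S' → toLex (I.setProfile S') ≤ toLex (I.setProfile S)

/-- A closed subset of lexicographically maximum profile among all closed subsets, where the
rotation profiles are reversed and negated. -/
def IsMaxRevNegProfileClosedSubset (I : SMI U W) (M₀ : Finset (U × W)) (S : Finset I.Rotation) :
    Prop :=
  I.IsClosedSubset M₀ S ∧
    ∀ S', I.IsClosedSubset M₀ S' → toLex (I.setRevNegProfile S') ≤ toLex (I.setRevNegProfile S)

/-- `M` is obtained from `M₀` by eliminating the rotations in `S`, each exactly once, in an order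
in which each of them is exposed when it is eliminated. -/
def ObtainedByEliminating (I : SMI U W) (M₀ : Finset (U × W)) (S : Finset I.Rotation)
    (M : Finset (U × W)) : Prop :=
  ∃ L : List I.Rotation, L.Nodup ∧ (∀ ρ, ρ ∈ L ↔ ρ ∈ S) ∧ I.EliminationSeq M₀ L M

end SMI

set_option linter.unusedSectionVars false

namespace SMI

variable {U W : Type*} [Fintype U] [Fintype W] [DecidableEq U] [DecidableEq W]

/-! Preprocessing makes every stable matching a bijection `U ≃ W`, and the proof tracks which
rotations such a matching `g` has `Passed`: those with a man whose `g`-partner is worse than his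
partner in the rotation. By `lt_of_passed` this then holds for all men of the rotation, and by
`passed_eliminate_iff` eliminating `ρ` adds exactly `ρ` to the passed rotations. As `M₀` has passed
none, every elimination sequence from `M₀` to `g` consists of the rotations passed by `g`, each
once; such a sequence exists by `exists_exposed_of_ne`.

The passed sets are exactly the closed sets. They are closed because a predecessor must occur
earlier in the sequence. Conversely, the men-best stable matching exposing `ρ` has passed precisely
the predecessors of `ρ`; eliminating `ρ` from it and taking joins over `ρ ∈ S` realizes every closed
`S`.

Along a sequence profiles telescope to `p(M) = p(M₀) + p(S)`. Lexicographic order is translation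
invariant and reversed by negation, so optimal closed sets give optimal matchings. -/

/-! ### Comparing two stable matchings -/

theorem manRank_inj {I : SMI U W} {m : U} {w w' : W} (hw : w ∈ I.manList m)
    (h : I.manRank m w = I.manRank m w') : w = w' :=
  (List.idxOf_inj hw).1 (Nat.succ_injective h)

theorem womanRank_inj {I : SMI U W} {w : W} {m m' : U} (hm : m ∈ I.womanList w)
    (h : I.womanRank w m = I.womanRank w m') : m = m' :=
  (List.idxOf_inj hm).1 (Nat.succ_injective h)

/-- Otherwise `(m, w)` would block `M`, so `w` has an `M`-partner at least as good as `m`; he is not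
`m`, who strictly prefers `w` to his `M`-partner. -/
theorem exists_woman_prefers_of_man_prefers {I : SMI U W} {M N : Finset (U × W)}
    (hM : I.IsStable M) (hN : I.IsStable N) {m : U} {w : W} (hw : (m, w) ∈ N)
    (hp : I.ManPrefers M m w) : ∃ m', (m', w) ∈ M ∧ I.WomanPrefers N w m' := by
  have hacc := hN.1.1 _ hw
  have h := hM.2 m w
  have h' : ∃ m', (m', w) ∈ M ∧ I.womanRank w m' ≤ I.womanRank w m := by
    by_contra! hc
    exact h ⟨hp, hacc.2, hc⟩
  obtain ⟨m', hm', hle⟩ := h'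
  refine ⟨m', hm', (hM.1.1 _ hm').2, fun m'' hm'' => ?_⟩
  obtain rfl := hN.1.2.2 _ _ _ hw hm''
  refine lt_of_le_of_ne hle fun he => ?_
  obtain rfl := womanRank_inj (hM.1.1 _ hm').2 he
  exact lt_irrefl _ (hp.2 _ hm')

theorem exists_man_prefers_of_woman_prefers {I : SMI U W} {M N : Finset (U × W)}
    (hM : I.IsStable M) (hN : I.IsStable N) {m : U} {w : W} (hw : (m, w) ∈ M)
    (hp : I.WomanPrefers N w m) : ∃ w', (m, w') ∈ N ∧ I.ManPrefers M m w' := by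
  have hacc := hM.1.1 _ hw
  have h := hN.2 m w
  have h' : ∃ w', (m, w') ∈ N ∧ I.manRank m w' ≤ I.manRank m w := by
    by_contra! hc
    exact h ⟨⟨hacc.1, hc⟩, hp⟩
  obtain ⟨w', hw', hle⟩ := h'
  refine ⟨w', hw', (hN.1.1 _ hw').1, fun w'' hw'' => ?_⟩
  obtain rfl := hM.1.2.1 _ _ _ hw hw''
  refine lt_of_le_of_ne hle fun he => ?_
  obtain rfl := manRank_inj (hN.1.1 _ hw').1 he
  exact absurd (hp.2 _ hw') (lt_irrefl _)

/-- The men who are better off in `N` than in `M` and the women who are better off in `M` than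
in `N` are matched with each other, both in `M` and in `N`. -/
theorem decomposition {I : SMI U W} {M N : Finset (U × W)}
    (hM : I.IsStable M) (hN : I.IsStable N) :
    (∀ m w, (m, w) ∈ N → I.ManPrefers M m w → ∃ w', (m, w') ∈ M ∧ I.WomanPrefers N w' m) ∧
    (∀ m w, (m, w) ∈ M → I.WomanPrefers N w m → ∃ m', (m', w) ∈ N ∧ I.ManPrefers M m' w) := by
  classical
  set A := N.filter fun p => I.ManPrefers M p.1 p.2 with hA
  set B := M.filter fun p => I.WomanPrefers N p.2 p.1 with hB
  have hAs : Set.InjOn Prod.snd (A : Set (U × W)) := by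
    rintro ⟨m, w⟩ h ⟨m', w'⟩ h' (rfl : w = w')
    simp only [hA, Finset.coe_filter, Set.mem_ofPred_eq] at h h'
    rw [hN.1.2.2 _ _ _ h.1 h'.1]
  have hAf : Set.InjOn Prod.fst (A : Set (U × W)) := by
    rintro ⟨m, w⟩ h ⟨m', w'⟩ h' (rfl : m = m')
    simp only [hA, Finset.coe_filter, Set.mem_ofPred_eq] at h h'
    rw [hN.1.2.1 _ _ _ h.1 h'.1]
  have hBs : Set.InjOn Prod.snd (B : Set (U × W)) := by
    rintro ⟨m, w⟩ h ⟨m', w'⟩ h' (rfl : w = w')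
    simp only [hB, Finset.coe_filter, Set.mem_ofPred_eq] at h h'
    rw [hM.1.2.2 _ _ _ h.1 h'.1]
  have hBf : Set.InjOn Prod.fst (B : Set (U × W)) := by
    rintro ⟨m, w⟩ h ⟨m', w'⟩ h' (rfl : m = m')
    simp only [hB, Finset.coe_filter, Set.mem_ofPred_eq] at h h'
    rw [hM.1.2.1 _ _ _ h.1 h'.1]
  -- Women of `A` occur in `B` and men of `B` occur in `A`. Nobody repeats in a matching, so `|A| ≤
  -- |B| ≤ |A|`, which turns both inclusions into equalities.
  have h1 : A.image Prod.snd ⊆ B.image Prod.snd := by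
    intro w hw
    obtain ⟨⟨m, w'⟩, hp, rfl⟩ := Finset.mem_image.1 hw
    obtain ⟨hp1, hp2⟩ := Finset.mem_filter.1 hp
    obtain ⟨m', hm', hpr⟩ := exists_woman_prefers_of_man_prefers hM hN hp1 hp2
    exact Finset.mem_image.2 ⟨(m', w'), Finset.mem_filter.2 ⟨hm', hpr⟩, rfl⟩
  have h2 : B.image Prod.fst ⊆ A.image Prod.fst := by
    intro m hm
    obtain ⟨⟨m', w⟩, hp, rfl⟩ := Finset.mem_image.1 hm
    obtain ⟨hp1, hp2⟩ := Finset.mem_filter.1 hp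
    obtain ⟨w', hw', hpr⟩ := exists_man_prefers_of_woman_prefers hM hN hp1 hp2
    exact Finset.mem_image.2 ⟨(m', w'), Finset.mem_filter.2 ⟨hw', hpr⟩, rfl⟩
  have c1 := Finset.card_le_card h1
  have c2 := Finset.card_le_card h2
  rw [Finset.card_image_of_injOn hAs, Finset.card_image_of_injOn hBs] at c1
  rw [Finset.card_image_of_injOn hAf, Finset.card_image_of_injOn hBf] at c2
  have e1 := Finset.eq_of_subset_of_card_le h1 (by
    rw [Finset.card_image_of_injOn hAs, Finset.card_image_of_injOn hBs]; exact c2)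
  have e2 := Finset.eq_of_subset_of_card_le h2 (by
    rw [Finset.card_image_of_injOn hAf, Finset.card_image_of_injOn hBf]; exact c1)
  constructor
  · intro m w hmw hp
    have : m ∈ B.image Prod.fst :=
      e2 ▸ Finset.mem_image.2 ⟨(m, w), Finset.mem_filter.2 ⟨hmw, hp⟩, rfl⟩
    obtain ⟨⟨m', w'⟩, hp', rfl⟩ := Finset.mem_image.1 this
    exact ⟨w', (Finset.mem_filter.1 hp').1, (Finset.mem_filter.1 hp').2⟩
  · intro m w hmw hp
    have : w ∈ A.image Prod.snd :=
      e1 ▸ Finset.mem_image.2 ⟨(m, w), Finset.mem_filter.2 ⟨hmw, hp⟩, rfl⟩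
    obtain ⟨⟨m', w'⟩, hp', rfl⟩ := Finset.mem_image.1 this
    exact ⟨m', (Finset.mem_filter.1 hp').1, (Finset.mem_filter.1 hp').2⟩

/-- A man unassigned in `M` vacuously prefers any stable partner, and `decomposition` then assigns
him in `M`. Hence all stable matchings are perfect. -/
theorem exists_partner_of_man {I : SMI U W} (hI : I.Preprocessed) {M : Finset (U × W)}
    (hM : I.IsStable M) (m : U) : ∃ w, (m, w) ∈ M := by
  obtain ⟨N, hN, w, hw⟩ := hI.1 m
  by_contra! hc
  obtain ⟨w', hw', -⟩ := (decomposition hM hN).1 m w hw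
    ⟨(hN.1.1 _ hw).1, fun w' hw' => absurd hw' (hc w')⟩
  exact hc w' hw'

theorem exists_partner_of_woman {I : SMI U W} (hI : I.Preprocessed) {M : Finset (U × W)}
    (hM : I.IsStable M) (w : W) : ∃ m, (m, w) ∈ M := by
  obtain ⟨N, hN, m, hm⟩ := hI.2 w
  by_contra! hc
  obtain ⟨m', hm', -⟩ := (decomposition hN hM).2 m w hm
    ⟨(hN.1.1 _ hm).2, fun m' hm' => absurd hm' (hc m')⟩
  exact absurd hm' (hc _)

/-! ### Stable matchings as bijections -/

/-- The set of pairs of a perfect matching given as a bijection. -/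
def graph (f : U ≃ W) : Finset (U × W) := Finset.univ.image fun m => (m, f m)

@[simp] theorem mem_graph {f : U ≃ W} {p : U × W} : p ∈ graph f ↔ f p.1 = p.2 := by
  simp only [graph, Finset.mem_image, Finset.mem_univ, true_and]
  constructor
  · rintro ⟨m, rfl⟩
    rfl
  · intro h
    exact ⟨p.1, Prod.ext rfl h⟩

theorem graph_injective : Function.Injective (graph : (U ≃ W) → Finset (U × W)) := by
  intro f g h
  ext m
  have : (m, f m) ∈ graph g := h ▸ mem_graph.2 rfl
  exact (mem_graph.1 this).symm

/-- Stability of a perfect matching given as a bijection. -/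
def IsStableEquiv (I : SMI U W) (f : U ≃ W) : Prop :=
  (∀ m, I.Acceptable m (f m)) ∧
    ∀ m w, I.Acceptable m w → I.manRank m w < I.manRank m (f m) →
      I.womanRank w (f.symm w) ≤ I.womanRank w m

theorem manPrefers_graph {I : SMI U W} {f : U ≃ W} {m : U} {w : W} :
    I.ManPrefers (graph f) m w ↔ w ∈ I.manList m ∧ I.manRank m w < I.manRank m (f m) := by
  simp [ManPrefers]

theorem womanPrefers_graph {I : SMI U W} {f : U ≃ W} {m : U} {w : W} :
    I.WomanPrefers (graph f) w m ↔
      m ∈ I.womanList w ∧ I.womanRank w m < I.womanRank w (f.symm w) := by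
  simp only [WomanPrefers, mem_graph]
  refine and_congr_right fun _ => ⟨fun h => h _ (f.apply_symm_apply w), ?_⟩
  rintro h m' rfl
  simpa using h

theorem isStable_graph {I : SMI U W} {f : U ≃ W} :
    I.IsStable (graph f) ↔ I.IsStableEquiv f := by
  simp only [IsStable, IsMatching, manPrefers_graph, womanPrefers_graph, IsStableEquiv]
  constructor
  · rintro ⟨⟨h1, -, -⟩, h2⟩
    refine ⟨fun m => h1 (m, f m) (by simp), fun m w ha hr => ?_⟩
    by_contra! hc
    exact h2 m w ⟨⟨ha.1, hr⟩, ha.2, hc⟩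
  · rintro ⟨h1, h2⟩
    refine ⟨⟨?_, ?_, ?_⟩, ?_⟩
    · rintro ⟨m, w⟩ h
      obtain rfl : f m = w := mem_graph.1 h
      exact h1 m
    · intro m w w' h h'
      exact (mem_graph.1 h).symm.trans (mem_graph.1 h')
    · intro m m' w h h'
      exact f.injective ((mem_graph.1 h).trans (mem_graph.1 h').symm)
    · rintro m w ⟨⟨ha, hr⟩, hb, hs⟩
      exact absurd (h2 m w ⟨ha, hb⟩ hr) (not_le.2 hs)

theorem exists_eq_graph {I : SMI U W} (hI : I.Preprocessed) {M : Finset (U × W)}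
    (hM : I.IsStable M) : ∃ f : U ≃ W, M = graph f := by
  choose a ha using exists_partner_of_man hI hM
  choose b hb using exists_partner_of_woman hI hM
  refine ⟨⟨a, b, fun m => hM.1.2.2 _ _ _ (hb _) (ha _), fun w => hM.1.2.1 _ _ _ (ha _) (hb _)⟩, ?_⟩
  ext ⟨m, w⟩
  rw [mem_graph]
  constructor
  · intro h
    exact hM.1.2.1 _ _ _ (ha _) h
  · intro h
    obtain rfl : a m = w := h
    exact ha m

/-! ### Lattice structure -/

namespace IsStableEquiv

variable {I : SMI U W} {f g : U ≃ W}

/-- If a man is better off in `g` than in `f`, his `f`-partner is better off in `f`. -/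
theorem woman_lt (hf : I.IsStableEquiv f) (hg : I.IsStableEquiv g) {m : U}
    (h : I.manRank m (g m) < I.manRank m (f m)) :
    I.womanRank (f m) m < I.womanRank (f m) (g.symm (f m)) := by
  obtain ⟨w', hw', hp⟩ := (decomposition (isStable_graph.2 hf) (isStable_graph.2 hg)).1 m (g m)
    (by simp) (manPrefers_graph.2 ⟨(hg.1 m).1, h⟩)
  obtain rfl : f m = w' := mem_graph.1 hw'
  exact (womanPrefers_graph.1 hp).2

/-- If a man is better off in `g` than in `f`, his `g`-partner is better off in `f`. -/
theorem woman_lt_of_eq (hf : I.IsStableEquiv f) (hg : I.IsStableEquiv g) {m : U}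
    (h : I.manRank m (g m) < I.manRank m (f m)) :
    I.womanRank (g m) (f.symm (g m)) < I.womanRank (g m) m := by
  refine lt_of_le_of_ne (hf.2 m (g m) (hg.1 m) h) fun he => ?_
  have := womanRank_inj (hg.1 m).2 he.symm
  have h2 : f m = g m := f.eq_symm_apply.1 this
  rw [h2] at h
  exact lt_irrefl _ h

theorem eq_of_manRank_eq (hf : I.IsStableEquiv f) {m : U} {w : W}
    (h : I.manRank m (f m) = I.manRank m w) : f m = w :=
  manRank_inj (hf.1 m).1 h

/-- The matching in which every man has the better of his partners in `f` and `g`. -/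
theorem exists_inf (hf : I.IsStableEquiv f) (hg : I.IsStableEquiv g) :
    ∃ k : U ≃ W, I.IsStableEquiv k ∧
      (∀ m, k m = if I.manRank m (f m) ≤ I.manRank m (g m) then f m else g m) ∧
      ∀ w, k.symm w = f.symm w ∨ k.symm w = g.symm w := by
  set a : U → W := fun m => if I.manRank m (f m) ≤ I.manRank m (g m) then f m else g m with ha
  -- A woman chosen from both matchings would strictly prefer each of her two partners to the other;
  -- a tie at `m` forces `m = m'`.
  have key : ∀ m m', I.manRank m (f m) ≤ I.manRank m (g m) →
      I.manRank m' (g m') < I.manRank m' (f m') → f m ≠ g m' := by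
    intro m m' h h' he
    have h1 := hf.woman_lt_of_eq hg h'
    rw [← he] at h1
    simp only [Equiv.symm_apply_apply] at h1
    rcases h.eq_or_lt with h2 | h2
    · have h3 := hf.eq_of_manRank_eq h2
      rw [he] at h3
      obtain rfl := g.injective h3
      exact absurd h1 (lt_irrefl _)
    · have h3 := hg.woman_lt_of_eq hf h2
      rw [he] at h3
      simp only [Equiv.symm_apply_apply] at h3
      rw [he] at h1
      exact lt_asymm h1 h3
  have hinj : Function.Injective a := by
    intro m m' h
    simp only [ha] at h
    split_ifs at h with h1 h2 h2
    · exact f.injective h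
    · exact absurd h (key m m' h1 (not_le.1 h2))
    · exact absurd h.symm (key m' m h2 (not_le.1 h1))
    · exact g.injective h
  have hbij : Function.Bijective a :=
    (Fintype.bijective_iff_injective_and_card a).2 ⟨hinj, Fintype.card_congr f⟩
  set k := Equiv.ofBijective a hbij with hk
  have hka : ∀ m, k m = if I.manRank m (f m) ≤ I.manRank m (g m) then f m else g m :=
    fun m => rfl
  have hor : ∀ m, k m = f m ∨ k m = g m := by
    intro m
    rw [hka]
    split_ifs <;> simp
  have hsymm : ∀ w, k.symm w = f.symm w ∨ k.symm w = g.symm w := by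
    intro w
    rcases hor (k.symm w) with h | h
    · left
      rw [Equiv.apply_symm_apply] at h
      exact (f.symm_apply_eq.2 h).symm
    · right
      rw [Equiv.apply_symm_apply] at h
      exact (g.symm_apply_eq.2 h).symm
  refine ⟨k, ⟨fun m => ?_, fun m w hacc hr => ?_⟩, hka, hsymm⟩
  · rcases hor m with h | h <;> rw [h]
    exacts [hf.1 m, hg.1 m]
  -- A man who prefers `w` to the better of his partners prefers her to both, so it does not matter
  -- from which matching the partner of `w` comes.
  · have h1 : I.manRank m w < I.manRank m (f m) ∧ I.manRank m w < I.manRank m (g m) := by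
      rw [hka] at hr
      split_ifs at hr with h <;> omega
    rcases hsymm w with h | h <;> rw [h]
    exacts [hf.2 m w hacc h1.1, hg.2 m w hacc h1.2]

/-- The matching in which every man has the worse of his partners in `f` and `g`. -/
theorem exists_sup (hf : I.IsStableEquiv f) (hg : I.IsStableEquiv g) :
    ∃ k : U ≃ W, I.IsStableEquiv k ∧
      (∀ m, k m = if I.manRank m (f m) ≤ I.manRank m (g m) then g m else f m) := by
  set a : U → W := fun m => if I.manRank m (f m) ≤ I.manRank m (g m) then g m else f m with ha
  have key : ∀ m m', I.manRank m (f m) ≤ I.manRank m (g m) →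
      I.manRank m' (g m') < I.manRank m' (f m') → g m ≠ f m' := by
    intro m m' h h' he
    have h1 := hf.woman_lt hg h'
    rw [← he] at h1
    simp only [Equiv.symm_apply_apply] at h1
    rcases h.eq_or_lt with h2 | h2
    · have h3 := hf.eq_of_manRank_eq h2
      rw [he] at h3
      obtain rfl := f.injective h3
      exact absurd h1 (lt_irrefl _)
    · have h3 := hg.woman_lt hf h2
      rw [he] at h3
      simp only [Equiv.symm_apply_apply] at h3
      rw [he] at h1
      exact lt_asymm h1 h3
  have hinj : Function.Injective a := by
    intro m m' h
    simp only [ha] at h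
    split_ifs at h with h1 h2 h2
    · exact g.injective h
    · exact absurd h (key m m' h1 (not_le.1 h2))
    · exact absurd h.symm (key m' m h2 (not_le.1 h1))
    · exact f.injective h
  have hbij : Function.Bijective a :=
    (Fintype.bijective_iff_injective_and_card a).2 ⟨hinj, Fintype.card_congr f⟩
  set k := Equiv.ofBijective a hbij with hk
  have hka : ∀ m, k m = if I.manRank m (f m) ≤ I.manRank m (g m) then g m else f m :=
    fun m => rfl
  -- Every woman receives the better of her two partners, so a pair blocking `k` would block the
  -- matching from which the man's partner is taken.
  have hle : ∀ w, I.womanRank w (k.symm w) ≤ I.womanRank w (f.symm w) ∧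
      I.womanRank w (k.symm w) ≤ I.womanRank w (g.symm w) := by
    intro w
    obtain ⟨m, rfl⟩ := k.surjective w
    rw [k.symm_apply_apply, hka]
    split_ifs with h
    · rcases h.eq_or_lt with h2 | h2
      · have h3 := hf.eq_of_manRank_eq h2
        have h4 : f.symm (g m) = m := by rw [← h3]; simp
        simp [h4]
      · have := hg.woman_lt hf h2
        simp [this.le]
    · have := hf.woman_lt hg (not_le.1 h)
      simp [this.le]
  refine ⟨k, ⟨fun m => ?_, fun m w hacc hr => ?_⟩, hka⟩
  · rw [hka]
    split_ifs
    exacts [hg.1 m, hf.1 m]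
  · rw [hka] at hr
    split_ifs at hr with h
    · exact (hle w).2.trans (hg.2 m w hacc hr)
    · exact (hle w).1.trans (hf.2 m w hacc hr)

end IsStableEquiv

/-! ### Exposed rotations, passing and elimination -/

/-- Exposure of a rotation in a perfect matching given as a bijection. -/
structure IsExposedEquiv (I : SMI U W) (f : U ≃ W) (ρ : Equiv.Perm (U × W)) : Prop where
  isCycle : ρ.IsCycle
  apply_eq : ∀ p ∈ ρ.support, f p.1 = p.2
  acceptable : ∀ p ∈ ρ.support, I.Acceptable p.1 (ρ p).2
  man_lt : ∀ p ∈ ρ.support, I.manRank p.1 p.2 < I.manRank p.1 (ρ p).2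
  woman_lt : ∀ p ∈ ρ.support, I.womanRank (ρ p).2 p.1 < I.womanRank (ρ p).2 (ρ p).1
  le_of_prefers : ∀ p ∈ ρ.support, ∀ w, I.Acceptable p.1 w → I.manRank p.1 p.2 < I.manRank p.1 w →
    I.womanRank w p.1 < I.womanRank w (f.symm w) → I.manRank p.1 (ρ p).2 ≤ I.manRank p.1 w

theorem isExposed_graph {I : SMI U W} {f : U ≃ W} {ρ : Equiv.Perm (U × W)} :
    I.IsExposed (graph f) ρ ↔ I.IsExposedEquiv f ρ := by
  have hsymm : ∀ p : U × W, f p.1 = p.2 → f.symm p.2 = p.1 := by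
    rintro p h
    rw [← h, f.symm_apply_apply]
  constructor
  · rintro ⟨hc, hs, hsucc⟩
    have hgr : ∀ p ∈ ρ.support, f p.1 = p.2 := fun p hp => mem_graph.1 (hs hp)
    have hsucc' : ∀ p ∈ ρ.support, (ρ p).2 ∈ I.manList p.1 ∧
        I.manRank p.1 p.2 < I.manRank p.1 (ρ p).2 ∧ I.WomanPrefers (graph f) (ρ p).2 p.1 ∧
        ∀ w', w' ∈ I.manList p.1 → I.manRank p.1 p.2 < I.manRank p.1 w' →
          I.WomanPrefers (graph f) w' p.1 → I.manRank p.1 (ρ p).2 ≤ I.manRank p.1 w' := by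
      intro p hp
      obtain ⟨w₀, hw₀, ⟨h1, h2, h3⟩, h4⟩ := hsucc p hp
      obtain rfl : p.2 = w₀ := (hgr p hp).symm.trans (mem_graph.1 hw₀)
      exact ⟨h1, h2, h3, h4⟩
    refine ⟨hc, hgr, fun p hp => ?_, fun p hp => (hsucc' p hp).2.1, fun p hp => ?_,
      fun p hp w hw hr hwr => ?_⟩
    · exact ⟨(hsucc' p hp).1, (hsucc' p hp).2.2.1.1⟩
    · have := (womanPrefers_graph.1 (hsucc' p hp).2.2.1).2
      rwa [hsymm _ (hgr _ (Equiv.Perm.apply_mem_support.2 hp))] at this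
    · exact (hsucc' p hp).2.2.2 w hw.1 hr (womanPrefers_graph.2 ⟨hw.2, hwr⟩)
  · intro h
    refine ⟨h.isCycle, fun p hp => mem_graph.2 (h.apply_eq p hp), fun p hp => ?_⟩
    refine ⟨p.2, mem_graph.2 (h.apply_eq p hp), ⟨(h.acceptable p hp).1, h.man_lt p hp, ?_⟩, ?_⟩
    · refine womanPrefers_graph.2 ⟨(h.acceptable p hp).2, ?_⟩
      rw [hsymm _ (h.apply_eq _ (Equiv.Perm.apply_mem_support.2 hp))]
      exact h.woman_lt p hp
    · intro w hw hr hp'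
      obtain ⟨h1, h2⟩ := womanPrefers_graph.1 hp'
      exact h.le_of_prefers p hp w ⟨hw, h1⟩ hr h2

/-- Some man of the rotation `ρ` has in `g` a worse partner than in `ρ`. -/
def Passed (I : SMI U W) (g : U ≃ W) (ρ : Equiv.Perm (U × W)) : Prop :=
  ∃ p ∈ ρ.support, I.manRank p.1 p.2 < I.manRank p.1 (g p.1)

namespace IsExposedEquiv

variable {I : SMI U W} {f g : U ≃ W} {ρ : Equiv.Perm (U × W)}

theorem symm_apply_eq (h : I.IsExposedEquiv f ρ) {p : U × W} (hp : p ∈ ρ.support) :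
    f.symm p.2 = p.1 := by
  rw [← h.apply_eq p hp, f.symm_apply_apply]

/-- The `g`-partner of a man who is worse off in `g` prefers him to her `f`-partner, so she competes
in the choice of his successor woman. -/
theorem le_of_lt (h : I.IsExposedEquiv f ρ) (hf : I.IsStableEquiv f) (hg : I.IsStableEquiv g)
    {p : U × W} (hp : p ∈ ρ.support) (hlt : I.manRank p.1 p.2 < I.manRank p.1 (g p.1)) :
    I.manRank p.1 (ρ p).2 ≤ I.manRank p.1 (g p.1) := by
  refine h.le_of_prefers p hp _ (hg.1 _) hlt ?_
  rw [← h.apply_eq p hp] at hlt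
  have := hg.woman_lt hf hlt
  exact this

/-- If `mᵢ₊₁` were not worse off, `wᵢ₊₁` would have a `g`-partner no better than `mᵢ₊₁`, hence worse
than `mᵢ`. Since `g` puts `mᵢ` strictly below `wᵢ₊₁`, the pair `(mᵢ, wᵢ₊₁)` would block `g`. -/
theorem lt_next (h : I.IsExposedEquiv f ρ) (hf : I.IsStableEquiv f) (hg : I.IsStableEquiv g)
    {p : U × W} (hp : p ∈ ρ.support) (hlt : I.manRank p.1 p.2 < I.manRank p.1 (g p.1)) :
    I.manRank (ρ p).1 (ρ p).2 < I.manRank (ρ p).1 (g (ρ p).1) := by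
  have hle := h.le_of_lt hf hg hp hlt
  have hq := Equiv.Perm.apply_mem_support.2 hp
  have hw := h.woman_lt p hp
  by_contra! hc
  have hge : I.womanRank (ρ p).2 (ρ p).1 ≤ I.womanRank (ρ p).2 (g.symm (ρ p).2) := by
    rcases hc.eq_or_lt with he | hlt'
    · have := hg.eq_of_manRank_eq he
      rw [← this, g.symm_apply_apply]
    · rw [← h.apply_eq _ hq] at hlt'
      have := hf.woman_lt hg hlt'
      rw [h.apply_eq _ hq] at this
      exact this.le
  have hne : I.manRank p.1 (ρ p).2 ≠ I.manRank p.1 (g p.1) := by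
    intro he
    have h1 := hg.eq_of_manRank_eq he.symm
    rw [← h1, g.symm_apply_apply, h1] at hge
    omega
  have := hg.2 p.1 (ρ p).2 (h.acceptable p hp) (lt_of_le_of_ne hle hne)
  omega

/-- A stable matching has passed a rotation either at all of its men or at none. -/
theorem lt_of_passed (h : I.IsExposedEquiv f ρ) (hf : I.IsStableEquiv f) (hg : I.IsStableEquiv g)
    (hpass : I.Passed g ρ) {p : U × W} (hp : p ∈ ρ.support) :
    I.manRank p.1 p.2 < I.manRank p.1 (g p.1) := by
  obtain ⟨q, hq, hlt⟩ := hpass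
  obtain ⟨n, rfl⟩ := h.isCycle.exists_pow_eq (Equiv.Perm.mem_support.1 hq)
    (Equiv.Perm.mem_support.1 hp)
  clear hp
  induction n with
  | zero => simpa using hlt
  | succ n ih =>
    rw [pow_succ', Equiv.Perm.mul_apply]
    exact h.lt_next hf hg (Equiv.Perm.pow_apply_mem_support.2 hq) ih

theorem le_of_passed (h : I.IsExposedEquiv f ρ) (hf : I.IsStableEquiv f) (hg : I.IsStableEquiv g)
    (hpass : I.Passed g ρ) {p : U × W} (hp : p ∈ ρ.support) :
    I.manRank p.1 (ρ p).2 ≤ I.manRank p.1 (g p.1) :=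
  h.le_of_lt hf hg hp (h.lt_of_passed hf hg hpass hp)

theorem not_passed (h : I.IsExposedEquiv f ρ) : ¬ I.Passed f ρ := by
  rintro ⟨p, hp, hlt⟩
  rw [h.apply_eq p hp] at hlt
  exact lt_irrefl _ hlt

/-- Eliminating an exposed rotation from a stable matching yields a stable matching. -/
theorem exists_eliminate (h : I.IsExposedEquiv f ρ) (hf : I.IsStableEquiv f) :
    ∃ f' : U ≃ W, I.IsStableEquiv f' ∧ eliminate (graph f) ρ = graph f' ∧
      ∀ m, f' m = (ρ (m, f m)).2 := by
  have hgr : ∀ m, f (ρ (m, f m)).1 = (ρ (m, f m)).2 := by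
    intro m
    by_cases hm : (m, f m) ∈ ρ.support
    · exact h.apply_eq _ (Equiv.Perm.apply_mem_support.2 hm)
    · rw [Equiv.Perm.notMem_support.1 hm]
  -- Since `ρ` fixes pairs outside its support, this single formula also covers the men who do not
  -- move.
  have hinj : Function.Injective fun m => (ρ (m, f m)).2 := by
    intro m m' he
    dsimp only at he
    have h1 : ρ (m, f m) = ρ (m', f m') := by
      refine Prod.ext (f.injective ?_) he
      rw [hgr, hgr, he]
    exact congrArg Prod.fst (ρ.injective h1)
  set f' := Equiv.ofBijective _
    ((Fintype.bijective_iff_injective_and_card _).2 ⟨hinj, Fintype.card_congr f⟩) with hf'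
  have happ : ∀ m, f' m = (ρ (m, f m)).2 := fun m => rfl
  have hwle : ∀ w, I.womanRank w (f'.symm w) ≤ I.womanRank w (f.symm w) := by
    intro w
    obtain ⟨m, rfl⟩ := f'.surjective w
    rw [f'.symm_apply_apply, happ]
    by_cases hm : (m, f m) ∈ ρ.support
    · rw [h.symm_apply_eq (Equiv.Perm.apply_mem_support.2 hm)]
      exact (h.woman_lt _ hm).le
    · rw [Equiv.Perm.notMem_support.1 hm]
      simp
  refine ⟨f', ⟨fun m => ?_, fun m w hacc hr => ?_⟩, ?_, happ⟩
  · rw [happ]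
    by_cases hm : (m, f m) ∈ ρ.support
    · exact h.acceptable _ hm
    · rw [Equiv.Perm.notMem_support.1 hm]
      exact hf.1 m
  · rw [happ] at hr
    -- Women only gain, so a woman above the old partner cannot block. One strictly between the old
    -- and new partners who blocks would have been an earlier successor.
    rcases lt_trichotomy (I.manRank m w) (I.manRank m (f m)) with h1 | h1 | h1
    · exact (hwle w).trans (hf.2 m w hacc h1)
    · obtain rfl := hf.eq_of_manRank_eq h1.symm
      simpa using hwle (f m)
    · by_cases hm : (m, f m) ∈ ρ.support
      · by_contra! hc
        exact absurd (h.le_of_prefers _ hm w hacc h1 (hc.trans_le (hwle w))) (not_le.2 hr)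
      · rw [Equiv.Perm.notMem_support.1 hm] at hr
        exact absurd h1 (lt_asymm hr)
  · ext ⟨m, w⟩
    simp only [eliminate, newPairs, Finset.mem_union, Finset.mem_sdiff, mem_graph,
      Finset.mem_image, happ]
    constructor
    · rintro (⟨h1, h2⟩ | ⟨p, hp, he⟩)
      · subst h1
        rw [Equiv.Perm.notMem_support.1 h2]
      · obtain ⟨rfl, rfl⟩ := Prod.mk.inj he
        rw [h.apply_eq p hp]
    · intro he
      by_cases hm : (m, f m) ∈ ρ.support
      · exact Or.inr ⟨_, hm, by rw [he]⟩
      · rw [Equiv.Perm.notMem_support.1 hm] at he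
        dsimp only at he
        subst he
        exact Or.inl ⟨rfl, hm⟩

/-- Eliminating `ρ` changes the set of rotations passed exactly by adding `ρ`. -/
theorem passed_eliminate_iff (h : I.IsExposedEquiv f ρ) (hf : I.IsStableEquiv f) {f' : U ≃ W}
    (hf' : I.IsStableEquiv f') (happ : ∀ m, f' m = (ρ (m, f m)).2)
    {π : Equiv.Perm (U × W)} (hπ : I.IsExposedEquiv g π) (hg : I.IsStableEquiv g) :
    I.Passed f' π ↔ π = ρ ∨ I.Passed f π := by
  have hle : ∀ m, I.manRank m (f m) ≤ I.manRank m (f' m) := by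
    intro m
    rw [happ]
    by_cases hm : (m, f m) ∈ ρ.support
    · exact (h.man_lt _ hm).le
    · rw [Equiv.Perm.notMem_support.1 hm]
  constructor
  · intro hpass
    by_contra! hc
    obtain ⟨hne, hnp⟩ := hc
    have hnot : ∀ p ∈ π.support, I.manRank p.1 (f p.1) ≤ I.manRank p.1 p.2 := by
      intro p hp
      by_contra! hlt
      exact hnp ⟨p, hp, hlt⟩
    have hlt : ∀ p ∈ π.support, I.manRank p.1 p.2 < I.manRank p.1 (f' p.1) :=
      fun p hp => hπ.lt_of_passed hg hf' hpass hp
    have hmem : ∀ p ∈ π.support, (p.1, f p.1) ∈ ρ.support := by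
      intro p hp
      by_contra hm
      have h1 := hlt p hp
      rw [happ, Equiv.Perm.notMem_support.1 hm] at h1
      exact absurd (hnot p hp) (not_le.2 h1)
    -- Had `g` passed `ρ`, a man of `π` would be in `g` at or below his `f'`-partner, although `f'`
    -- puts him strictly below his partner in `π`, which is his `g`-partner.
    have hgnp : ¬ I.Passed g ρ := by
      intro hgp
      obtain ⟨p, hp, -⟩ := hpass
      have h1 := h.le_of_passed hf hg hgp (hmem p hp)
      have h2 := hlt p hp
      rw [happ] at h2
      rw [hπ.apply_eq p hp] at h1
      exact absurd h1 (not_le.2 h2)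
    have hfeq : ∀ p ∈ π.support, f p.1 = p.2 := by
      intro p hp
      refine hf.eq_of_manRank_eq (le_antisymm (hnot p hp) ?_)
      by_contra! h1
      refine hgnp ⟨_, hmem p hp, ?_⟩
      rw [hπ.apply_eq p hp]
      exact h1
    have hsub : ∀ p ∈ π.support, p ∈ ρ.support := by
      intro p hp
      have := hmem p hp
      rwa [hfeq p hp] at this
    -- The woman given by `π` is a candidate successor in `f`, and `f'` has moved the man at least
    -- as far as her; hence both rotations choose the same woman.
    have hagree : ∀ p ∈ π.support, π p = ρ p := by
      intro p hp
      have hq := Equiv.Perm.apply_mem_support.2 hp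
      have hs := h.le_of_prefers p (hsub p hp) (π p).2 (hπ.acceptable p hp) (hπ.man_lt p hp) (by
        have : f.symm (π p).2 = (π p).1 := by rw [← hfeq _ hq, f.symm_apply_apply]
        rw [this]
        exact hπ.woman_lt p hp)
      have hs' := hπ.le_of_passed hg hf' hpass hp
      rw [happ, hfeq p hp] at hs'
      have h2 : (ρ p).2 = (π p).2 :=
        manRank_inj (h.acceptable p (hsub p hp)).1 (le_antisymm hs hs')
      refine Prod.ext (f.injective ?_) h2.symm
      rw [hfeq _ hq, h.apply_eq _ (Equiv.Perm.apply_mem_support.2 (hsub p hp)), h2]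
    refine hne ?_
    obtain ⟨p, hp, -⟩ := hpass
    -- Following the cycle `ρ` from a pair of `π` never leaves `π`.
    have hsupp : ρ.support ⊆ π.support := by
      intro q hq
      obtain ⟨n, rfl⟩ := h.isCycle.exists_pow_eq (Equiv.Perm.mem_support.1 (hsub p hp))
        (Equiv.Perm.mem_support.1 hq)
      clear hq
      induction n with
      | zero => simpa using hp
      | succ n ih =>
        rw [pow_succ', Equiv.Perm.mul_apply, ← hagree _ ih]
        exact Equiv.Perm.apply_mem_support.2 ih
    ext1 q
    by_cases hq : q ∈ π.support
    · exact hagree q hq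
    · rw [Equiv.Perm.notMem_support.1 hq, Equiv.Perm.notMem_support.1 fun h' => hq (hsupp h')]
  · rintro (rfl | ⟨p, hp, hlt⟩)
    · obtain ⟨p, hp⟩ := h.isCycle.nonempty_support
      refine ⟨p, hp, ?_⟩
      rw [happ, h.apply_eq p hp]
      exact h.man_lt p hp
    · exact ⟨p, hp, hlt.trans_le (hle _)⟩

end IsExposedEquiv

/-! ### Existence of exposed rotations -/

/-- A self-map of a finite type without fixed points in a nonempty invariant set `D` agrees with
a cyclic permutation on some orbit in `D`. -/
theorem exists_isCycle_of_mapsTo {α : Type*} [Fintype α] [DecidableEq α] (t : α → α) (D : Set α)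
    (hD : ∀ x ∈ D, t x ∈ D) (hne : ∀ x ∈ D, t x ≠ x) {x₀ : α} (hx₀ : x₀ ∈ D) :
    ∃ ρ : Equiv.Perm α, ρ.IsCycle ∧ ∀ x ∈ ρ.support, x ∈ D ∧ ρ x = t x := by
  classical
  have hiter : ∀ n, t^[n] x₀ ∈ D := by
    intro n
    induction n with
    | zero => exact hx₀
    | succ n ih => rw [Function.iterate_succ_apply']; exact hD _ ih
  obtain ⟨x, hxD, hxP⟩ : ∃ x ∈ D, x ∈ Function.periodicPts t := by
    obtain ⟨i, j, hij, he⟩ := Finite.exists_ne_map_eq_of_infinite fun n : ℕ => t^[n] x₀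
    wlog h : i < j generalizing i j
    · exact this j i hij.symm he.symm (by omega)
    refine ⟨t^[i] x₀, hiter i, Function.mk_mem_periodicPts (n := j - i) (by omega) ?_⟩
    rw [Function.IsPeriodicPt, Function.IsFixedPt, ← Function.iterate_add_apply,
      Nat.sub_add_cancel h.le]
    exact he.symm
  have hbij := Function.bijOn_periodicPts t
  -- On its periodic points in `D` the map is injective, hence a permutation; it is extended by the
  -- identity and restricted to one cycle.
  let P : α → Prop := fun y => y ∈ D ∧ y ∈ Function.periodicPts t
  let r : Subtype P → Subtype P := fun y => ⟨t y, hD _ y.2.1, hbij.mapsTo y.2.2⟩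
  have hr : Function.Injective r := by
    intro y z h
    exact Subtype.ext (hbij.injOn y.2.2 z.2.2 (congrArg Subtype.val h))
  let σ : Equiv.Perm α :=
    Equiv.Perm.ofSubtype (Equiv.ofBijective r (Finite.injective_iff_bijective.1 hr))
  have hσ : ∀ y, P y → σ y = t y := fun y hy => Equiv.Perm.ofSubtype_apply_of_mem _ hy
  have hσ' : ∀ y, ¬ P y → σ y = y := fun y hy => Equiv.Perm.ofSubtype_apply_of_not_mem _ hy
  have hx : σ x ≠ x := by
    rw [hσ x ⟨hxD, hxP⟩]
    exact hne x hxD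
  refine ⟨σ.cycleOf x, σ.isCycle_cycleOf hx, fun y hy => ?_⟩
  have hy' := (Equiv.Perm.mem_support_cycleOf_iff.1 hy).1
  have hys : y ∈ σ.support := Equiv.Perm.support_cycleOf_le σ x hy
  have hPy : P y := by
    by_contra h
    exact Equiv.Perm.mem_support.1 hys (hσ' y h)
  exact ⟨hPy.1, hy'.cycleOf_apply.trans (hσ y hPy)⟩

/-- If every man weakly prefers `f` to `g ≠ f`, some rotation exposed in `f` is passed by `g`. -/
theorem exists_exposed_of_ne {I : SMI U W} {f g : U ≃ W} (hf : I.IsStableEquiv f)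
    (hg : I.IsStableEquiv g) (hle : ∀ m, I.manRank m (f m) ≤ I.manRank m (g m)) (hne : f ≠ g) :
    ∃ ρ, I.IsExposedEquiv f ρ ∧ I.Passed g ρ := by
  have hstep : ∀ m, I.manRank m (f m) < I.manRank m (g m) → ∃ w, I.Acceptable m w ∧
      I.manRank m (f m) < I.manRank m w ∧ I.womanRank w m < I.womanRank w (f.symm w) ∧
      (∀ w', I.Acceptable m w' → I.manRank m (f m) < I.manRank m w' →
        I.womanRank w' m < I.womanRank w' (f.symm w') → I.manRank m w ≤ I.manRank m w') ∧
      I.manRank (f.symm w) w < I.manRank (f.symm w) (g (f.symm w)) := by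
    intro m hm
    have hex : ∃ w, I.Acceptable m w ∧ I.manRank m (f m) < I.manRank m w ∧
        I.womanRank w m < I.womanRank w (f.symm w) := ⟨g m, hg.1 m, hm, hg.woman_lt hf hm⟩
    obtain ⟨w, ⟨h1, h2, h3⟩, hmin⟩ := exists_minimalFor_of_wellFoundedLT
      (fun w => I.Acceptable m w ∧ I.manRank m (f m) < I.manRank m w ∧
        I.womanRank w m < I.womanRank w (f.symm w)) (I.manRank m) hex
    have hmin' : ∀ w', I.Acceptable m w' → I.manRank m (f m) < I.manRank m w' →
        I.womanRank w' m < I.womanRank w' (f.symm w') → I.manRank m w ≤ I.manRank m w' := by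
      intro w' ha hb hc
      rcases le_total (I.manRank m w) (I.manRank m w') with h | h
      · exact h
      · exact hmin ⟨ha, hb, hc⟩ h
    refine ⟨w, h1, h2, h3, hmin', ?_⟩
    have hle' := hle (f.symm w)
    rw [f.apply_symm_apply] at hle'
    -- If the `f`-partner of `w` kept her in `g`, then `m`, whose `g`-partner lies strictly below
    -- `w`, would block `g` with her.
    refine lt_of_le_of_ne hle' fun he => ?_
    have hgw : g (f.symm w) = w := hg.eq_of_manRank_eq he.symm
    have hgs : g.symm w = f.symm w := by rw [g.symm_apply_eq, hgw]
    have hwg := hmin' (g m) (hg.1 m) hm (hg.woman_lt hf hm)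
    have hlt : I.manRank m w < I.manRank m (g m) := by
      refine lt_of_le_of_ne hwg fun he' => ?_
      have h4 := hg.eq_of_manRank_eq he'.symm
      have h5 : m = f.symm w := g.injective (h4.trans hgw.symm)
      rw [← h5] at h3
      exact lt_irrefl _ h3
    have := hg.2 m w h1 hlt
    rw [hgs] at this
    exact absurd h3 (not_lt.2 this)
  obtain ⟨m₀, hm₀⟩ : ∃ m, I.manRank m (f m) < I.manRank m (g m) := by
    by_contra! hc
    exact hne (Equiv.ext fun m => hf.eq_of_manRank_eq (le_antisymm (hle m) (hc m)))
  have : Nonempty W := ⟨f m₀⟩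
  choose! s hacc hman hwoman hmin hnext using hstep
  -- Passing from a man to the `f`-partner of his successor woman preserves the set of men worse off
  -- in `g`, so it contains a cycle.
  obtain ⟨ρ, hcyc, hρ⟩ := exists_isCycle_of_mapsTo
    (fun p : U × W => (f.symm (s p.1), s p.1))
    {p | f p.1 = p.2 ∧ I.manRank p.1 (f p.1) < I.manRank p.1 (g p.1)}
    (fun p hp => ⟨f.apply_symm_apply _, by
      rw [f.apply_symm_apply]
      exact hnext p.1 hp.2⟩)
    (fun p hp he => by
      have h1 := hman p.1 hp.2
      have h2 : s p.1 = p.2 := congrArg Prod.snd he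
      rw [h2, ← hp.1] at h1
      exact lt_irrefl _ h1)
    (x₀ := (m₀, f m₀)) ⟨rfl, hm₀⟩
  refine ⟨ρ, ⟨hcyc, fun p hp => (hρ p hp).1.1, fun p hp => ?_, fun p hp => ?_, fun p hp => ?_,
    fun p hp w hw hr hwr => ?_⟩, ?_⟩
  · rw [(hρ p hp).2]
    exact hacc p.1 (hρ p hp).1.2
  · rw [(hρ p hp).2, ← (hρ p hp).1.1]
    exact hman p.1 (hρ p hp).1.2
  · rw [(hρ p hp).2]
    exact hwoman p.1 (hρ p hp).1.2
  · rw [(hρ p hp).2]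
    rw [← (hρ p hp).1.1] at hr
    exact hmin p.1 (hρ p hp).1.2 w hw hr hwr
  · obtain ⟨p, hp⟩ := hcyc.nonempty_support
    refine ⟨p, hp, ?_⟩
    have := (hρ p hp).1.2
    rwa [(hρ p hp).1.1] at this

/-! ### Elimination sequences and telescoping -/

variable {I : SMI U W} {f g : U ≃ W}

instance finite_rotation : Finite I.Rotation := by
  unfold Rotation
  infer_instance

theorem Rotation.exists_exposed (hI : I.Preprocessed) (ρ : I.Rotation) :
    ∃ g, I.IsStableEquiv g ∧ I.IsExposedEquiv g ρ.1 := by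
  obtain ⟨M, hM, hρ⟩ := ρ.2
  obtain ⟨g, rfl⟩ := exists_eq_graph hI hM
  exact ⟨g, isStable_graph.1 hM, isExposed_graph.1 hρ⟩

theorem Passed.mono {ρ : Equiv.Perm (U × W)} (hle : ∀ m, I.manRank m (f m) ≤ I.manRank m (g m))
    (h : I.Passed f ρ) : I.Passed g ρ := by
  obtain ⟨p, hp, hlt⟩ := h
  exact ⟨p, hp, hlt.trans_le (hle _)⟩

/-- A sequence of eliminations consists of distinct rotations, none of them passed initially, and
adds exactly these to the rotations passed. -/
theorem EliminationSeq.spec (hI : I.Preprocessed) (hf : I.IsStableEquiv f)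
    {L : List I.Rotation} {M : Finset (U × W)} (h : I.EliminationSeq (graph f) L M) :
    ∃ g, I.IsStableEquiv g ∧ M = graph g ∧ L.Nodup ∧ (∀ ρ ∈ L, ¬ I.Passed f ρ.1) ∧
      ∀ ρ : I.Rotation, I.Passed g ρ.1 ↔ ρ ∈ L ∨ I.Passed f ρ.1 := by
  generalize hM₁ : graph f = M₁ at h
  induction h generalizing f with
  | nil M => exact ⟨f, hf, hM₁.symm, List.nodup_nil, by simp, by simp⟩
  | @cons M M' ρ L hρ _ ih =>
    subst hM₁
    have hρ' := isExposed_graph.1 hρ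
    obtain ⟨f', hf', he, happ⟩ := hρ'.exists_eliminate hf
    obtain ⟨g, hg, rfl, hnd, hnp, hiff⟩ := ih hf' he.symm
    have hpass : ∀ π : I.Rotation, I.Passed f' π.1 ↔ π = ρ ∨ I.Passed f π.1 := by
      intro π
      obtain ⟨k, hk, hπ⟩ := π.exists_exposed hI
      rw [hρ'.passed_eliminate_iff hf hf' happ hπ hk]
      exact or_congr_left Subtype.ext_iff.symm
    -- After its elimination `ρ` is passed, so it cannot be eliminated again.
    refine ⟨g, hg, rfl, List.nodup_cons.2 ⟨fun hmem => hnp ρ hmem ((hpass ρ).2 (Or.inl rfl)), hnd⟩,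
      ?_, fun π => ?_⟩
    · intro π hπ hp
      rcases List.mem_cons.1 hπ with rfl | hπ
      · exact hρ'.not_passed hp
      · exact hnp π hπ ((hpass π).2 (Or.inr hp))
    · rw [hiff, hpass, List.mem_cons]
      tauto

/-- A stable matching is reached by eliminations from every stable matching that the men weakly
prefer to it. -/
theorem exists_eliminationSeq (hf : I.IsStableEquiv f) (hg : I.IsStableEquiv g)
    (hle : ∀ m, I.manRank m (f m) ≤ I.manRank m (g m)) :
    ∃ L, I.EliminationSeq (graph f) L (graph g) := by
  -- Each elimination shrinks the total distance to `g`; `hle` makes the truncated subtraction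
  -- exact.
  generalize hn : ∑ m, (I.manRank m (g m) - I.manRank m (f m)) = n
  induction n using Nat.strong_induction_on generalizing f with
  | _ n ih =>
    by_cases hfg : f = g
    · subst hfg
      exact ⟨[], .nil _⟩
    obtain ⟨ρ, hρ, hpass⟩ := exists_exposed_of_ne hf hg hle hfg
    obtain ⟨f', hf', he, happ⟩ := hρ.exists_eliminate hf
    have hle' : ∀ m, I.manRank m (f m) ≤ I.manRank m (f' m) ∧
        I.manRank m (f' m) ≤ I.manRank m (g m) := by
      intro m
      rw [happ]
      by_cases hm : (m, f m) ∈ ρ.support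
      · exact ⟨(hρ.man_lt _ hm).le, hρ.le_of_passed hf hg hpass hm⟩
      · rw [Equiv.Perm.notMem_support.1 hm]
        exact ⟨le_rfl, hle m⟩
    have hlt : ∑ m, (I.manRank m (g m) - I.manRank m (f' m)) < n := by
      rw [← hn]
      obtain ⟨p, hp, -⟩ := hpass
      refine Finset.sum_lt_sum (fun m _ => by have := hle' m; omega) ⟨p.1, Finset.mem_univ _, ?_⟩
      have h1 := hle' p.1
      have h2 : I.manRank p.1 (f p.1) < I.manRank p.1 (f' p.1) := by
        rw [happ, hρ.apply_eq p hp]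
        exact hρ.man_lt p hp
      omega
    obtain ⟨L, hL⟩ := ih _ hlt hf' (fun m => (hle' m).2) rfl
    let ρ' : I.Rotation := ⟨ρ, graph f, isStable_graph.2 hf, isExposed_graph.2 hρ⟩
    exact ⟨ρ' :: L, .cons (ρ := ρ') (isExposed_graph.2 hρ) (he ▸ hL)⟩

/-- A quantity whose change under eliminations depends only on the rotation. -/
theorem EliminationSeq.sum_eq {A : Type*} [AddCommGroup A] (F : Finset (U × W) → A)
    (G : Equiv.Perm (U × W) → A)
    (hFG : ∀ M ρ, I.IsStable M → I.IsExposed M ρ → G ρ = F (eliminate M ρ) - F M)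
    (hf : I.IsStableEquiv f) {L : List I.Rotation} {M : Finset (U × W)}
    (h : I.EliminationSeq (graph f) L M) : F M = F (graph f) + (L.map fun ρ => G ρ.1).sum := by
  generalize hM₁ : graph f = M₁ at h
  induction h generalizing f with
  | nil M => simp
  | @cons M M' ρ L hρ _ ih =>
    subst hM₁
    obtain ⟨f', hf', he, -⟩ := (isExposed_graph.1 hρ).exists_eliminate hf
    rw [ih hf' he.symm, List.map_cons, List.sum_cons, hFG _ _ (isStable_graph.2 hf) hρ]
    abel

/-- The change of the set of pairs, as an indicator function, under the elimination of `ρ`. -/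
def indicatorChange (ρ : Equiv.Perm (U × W)) : U × W → ℤ := fun p =>
  (if p ∈ newPairs ρ then 1 else 0) - (if p ∈ ρ.support then 1 else 0)

theorem indicatorChange_eq {M : Finset (U × W)} {ρ : Equiv.Perm (U × W)} (hM : I.IsStable M)
    (hρ : I.IsExposed M ρ) : indicatorChange ρ =
      (fun p => if p ∈ eliminate M ρ then (1 : ℤ) else 0) -
        fun p => if p ∈ M then (1 : ℤ) else 0 := by
  obtain ⟨-, hs, hsucc⟩ := hρ
  have hd : ∀ p ∈ newPairs ρ, p ∉ M := by
    intro x hx' hx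
    obtain ⟨p, hp, rfl⟩ := Finset.mem_image.1 hx'
    obtain ⟨w₀, hw₀, ⟨-, hlt, -⟩, -⟩ := hsucc p hp
    have := hM.1.2.1 _ _ _ hw₀ hx
    rw [this] at hlt
    exact lt_irrefl _ hlt
  funext p
  have h1 := hd p
  have h2 := @hs p
  simp only [indicatorChange, eliminate, Pi.sub_apply, Finset.mem_union, Finset.mem_sdiff]
  by_cases ha : p ∈ newPairs ρ <;> by_cases hb : p ∈ ρ.support <;> by_cases hc : p ∈ M <;>
    simp_all

theorem sum_map_eq_of_mem_iff {A : Type*} [AddCommMonoid A] (G : Equiv.Perm (U × W) → A)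
    {L : List I.Rotation} (hL : L.Nodup) {S : Finset I.Rotation} (hS : ∀ ρ, ρ ∈ L ↔ ρ ∈ S) :
    (L.map fun ρ => G ρ.1).sum = ∑ ρ ∈ S, G ρ.1 := by
  classical
  rw [← List.sum_toFinset _ hL]
  exact Finset.sum_congr (by ext; simp [hS]) fun _ _ => rfl

/-- The indicator function of the pairs changes by an amount depending only on the rotation, so the
final one is a sum over `S`, insensitive to order. -/
theorem ObtainedByEliminating.unique (hf : I.IsStableEquiv f) {S : Finset I.Rotation}
    {M M' : Finset (U × W)} (h : I.ObtainedByEliminating (graph f) S M)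
    (h' : I.ObtainedByEliminating (graph f) S M') : M = M' := by
  obtain ⟨L, hL, hS, hseq⟩ := h
  obtain ⟨L', hL', hS', hseq'⟩ := h'
  have e := hseq.sum_eq (fun M p => if p ∈ M then (1 : ℤ) else 0) indicatorChange
    (fun _ _ => indicatorChange_eq) hf
  have e' := hseq'.sum_eq (fun M p => if p ∈ M then (1 : ℤ) else 0) indicatorChange
    (fun _ _ => indicatorChange_eq) hf
  rw [sum_map_eq_of_mem_iff _ hL hS] at e
  rw [sum_map_eq_of_mem_iff _ hL' hS', ← e] at e'
  ext p
  have := congrFun e' p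
  by_cases h1 : p ∈ M <;> by_cases h2 : p ∈ M' <;> simp_all

theorem ObtainedByEliminating.profile_eq (hf : I.IsStableEquiv f) {S : Finset I.Rotation}
    {M : Finset (U × W)} (h : I.ObtainedByEliminating (graph f) S M) :
    I.profile M = I.profile (graph f) + I.setProfile S := by
  obtain ⟨L, hL, hS, hseq⟩ := h
  rw [hseq.sum_eq I.profile I.rotationProfile (fun _ _ hM hρ => I.profile_eliminate hM hρ) hf,
    sum_map_eq_of_mem_iff _ hL hS, setProfile]

theorem EliminationSeq.exists_exposed_of_append {M M' : Finset (U × W)} {L L' : List I.Rotation}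
    {ρ : I.Rotation} (h : I.EliminationSeq M (L ++ ρ :: L') M') :
    ∃ M₁, I.EliminationSeq M L M₁ ∧ I.IsExposed M₁ ρ.1 := by
  induction L generalizing M with
  | nil =>
    cases h with
    | cons hρ _ => exact ⟨M, .nil M, hρ⟩
  | cons π L ih =>
    cases h with
    | cons hπ h =>
      obtain ⟨M₁, h1, h2⟩ := ih h
      exact ⟨M₁, .cons hπ h1, h2⟩

/-- Exposure is preserved if every man gets the better of his partners. -/
theorem IsExposedEquiv.inf {k : U ≃ W} {ρ : Equiv.Perm (U × W)} (hf : I.IsExposedEquiv f ρ)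
    (hg : I.IsExposedEquiv g ρ) (hk : ∀ m, k m = f m ∨ k m = g m)
    (hks : ∀ w, k.symm w = f.symm w ∨ k.symm w = g.symm w) : I.IsExposedEquiv k ρ where
  isCycle := hf.isCycle
  apply_eq p hp := by
    rcases hk p.1 with h | h <;> rw [h]
    exacts [hf.apply_eq p hp, hg.apply_eq p hp]
  acceptable := hf.acceptable
  man_lt := hf.man_lt
  woman_lt := hf.woman_lt
  le_of_prefers p hp w hw hr hwr := by
    rcases hks w with h | h <;> rw [h] at hwr
    exacts [hf.le_of_prefers p hp w hw hr hwr, hg.le_of_prefers p hp w hw hr hwr]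

/-! ### Closed sets as sets of passed rotations -/

/-- A perfect matching in which every man has his best stable partner. -/
def IsManOptimalEquiv (I : SMI U W) (f : U ≃ W) : Prop :=
  I.IsStableEquiv f ∧ ∀ g, I.IsStableEquiv g → ∀ m, I.manRank m (f m) ≤ I.manRank m (g m)

theorem IsManOptimal.isManOptimalEquiv (h : I.IsManOptimal (graph f)) : I.IsManOptimalEquiv f := by
  refine ⟨isStable_graph.1 h.1, fun g hg m => ?_⟩
  obtain ⟨w₀, hw₀, hle⟩ := h.2 _ (isStable_graph.2 hg) m (g m) (by simp)
  obtain rfl : f m = w₀ := mem_graph.1 hw₀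
  exact hle

namespace IsManOptimalEquiv

theorem not_passed (hf : I.IsManOptimalEquiv f) (hI : I.Preprocessed) (ρ : I.Rotation) :
    ¬ I.Passed f ρ.1 := by
  rintro ⟨p, hp, hlt⟩
  obtain ⟨g, hg, hρ⟩ := ρ.exists_exposed hI
  have := hf.2 g hg p.1
  rw [hρ.apply_eq p hp] at this
  omega

theorem exists_eliminationSeq (hf : I.IsManOptimalEquiv f) (hI : I.Preprocessed)
    (hg : I.IsStableEquiv g) :
    ∃ L, L.Nodup ∧ (∀ ρ : I.Rotation, ρ ∈ L ↔ I.Passed g ρ.1) ∧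
      I.EliminationSeq (graph f) L (graph g) := by
  obtain ⟨L, hL⟩ := SMI.exists_eliminationSeq hf.1 hg (hf.2 g hg)
  obtain ⟨g', -, he, hnd, -, hiff⟩ := hL.spec hI hf.1
  obtain rfl := graph_injective he
  refine ⟨L, hnd, fun ρ => ?_, hL⟩
  rw [hiff, or_iff_left (hf.not_passed hI ρ)]

theorem obtained_of_passed_iff (hf : I.IsManOptimalEquiv f) (hI : I.Preprocessed)
    (hg : I.IsStableEquiv g) {S : Finset I.Rotation}
    (hS : ∀ ρ : I.Rotation, I.Passed g ρ.1 ↔ ρ ∈ S) :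
    I.ObtainedByEliminating (graph f) S (graph g) := by
  obtain ⟨L, hnd, hiff, hL⟩ := hf.exists_eliminationSeq hI hg
  exact ⟨L, hnd, fun ρ => (hiff ρ).trans (hS ρ), hL⟩

/-- The rotations passed by a stable matching form a closed set. -/
theorem isClosedSubset_of_passed_iff (hf : I.IsManOptimalEquiv f) (hI : I.Preprocessed)
    (hg : I.IsStableEquiv g) {S : Finset I.Rotation}
    (hS : ∀ ρ : I.Rotation, I.Passed g ρ.1 ↔ ρ ∈ S) : I.IsClosedSubset (graph f) S := by
  intro ρ hρ π hπ
  obtain ⟨L, hnd, hiff, hL⟩ := hf.exists_eliminationSeq hI hg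
  have hmem : ∀ π, π ∈ L ↔ π ∈ S := fun π => (hiff π).trans (hS π)
  -- Cutting the sequence just before `ρ` leaves a matching exposing `ρ`, so `π` occurs in the
  -- prefix.
  obtain ⟨L₁, L₂, rfl⟩ := List.append_of_mem ((hmem ρ).2 hρ)
  obtain ⟨M₁, h1, h2⟩ := hL.exists_exposed_of_append
  exact (hmem π).1 (List.mem_append_left _ (hπ L₁ M₁ h1 h2))

/-- The most preferred stable matching in which `ρ` is exposed has passed exactly the
predecessors of `ρ`. -/
theorem exists_passed_iff_precedes (hf : I.IsManOptimalEquiv f) (hI : I.Preprocessed)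
    (ρ : I.Rotation) : ∃ k, I.IsStableEquiv k ∧ I.IsExposedEquiv k ρ.1 ∧
      ∀ π : I.Rotation, I.Passed k π.1 ↔ I.Precedes (graph f) π ρ := by
  obtain ⟨k, ⟨hk, hρ⟩, hmin⟩ := exists_minimalFor_of_wellFoundedLT
    (fun k : U ≃ W => I.IsStableEquiv k ∧ I.IsExposedEquiv k ρ.1)
    (fun k => ∑ m, I.manRank m (k m)) (ρ.exists_exposed hI)
  refine ⟨k, hk, hρ, fun π => ⟨fun hp L M hL hM => ?_, fun hpre => ?_⟩⟩
  · obtain ⟨g, hg, rfl, -, -, hiff⟩ := hL.spec hI hf.1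
    have hgρ := isExposed_graph.1 hM
    -- The meet of `k` and `g` still exposes `ρ`, so minimality of `k` forces it to be `k`. Thus `k`
    -- is at least as good as `g` for all men, and `g` has passed all that `k` has.
    obtain ⟨c, hc, hcapp, hcs⟩ := hk.exists_inf hg
    have hor : ∀ m, c m = k m ∨ c m = g m := by
      intro m
      rw [hcapp]
      split_ifs <;> simp
    have hle : ∀ m, I.manRank m (c m) ≤ I.manRank m (k m) ∧
        I.manRank m (c m) ≤ I.manRank m (g m) := by
      intro m
      rw [hcapp]
      split_ifs with h <;> omega
    have hsum : ∑ m, I.manRank m (c m) ≤ ∑ m, I.manRank m (k m) :=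
      Finset.sum_le_sum fun m _ => (hle m).1
    have hsum' := hmin ⟨hc, hρ.inf hgρ hor hcs⟩ hsum
    have heq := (Finset.sum_eq_sum_iff_of_le fun m _ => (hle m).1).1 (le_antisymm hsum hsum')
    have hkg : ∀ m, I.manRank m (k m) ≤ I.manRank m (g m) := by
      intro m
      rw [← heq m (Finset.mem_univ m)]
      exact (hle m).2
    have := (hiff π).1 (hp.mono hkg)
    exact this.resolve_right (hf.not_passed hI π)
  · obtain ⟨L, -, hiff, hL⟩ := hf.exists_eliminationSeq hI hk
    exact (hiff π).1 (hpre L _ hL (isExposed_graph.2 hρ))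

theorem exists_passed_iff_eq_or_precedes (hf : I.IsManOptimalEquiv f) (hI : I.Preprocessed)
    (ρ : I.Rotation) : ∃ k, I.IsStableEquiv k ∧
      ∀ π : I.Rotation, I.Passed k π.1 ↔ π = ρ ∨ I.Precedes (graph f) π ρ := by
  obtain ⟨k, hk, hρ, hiff⟩ := hf.exists_passed_iff_precedes hI ρ
  obtain ⟨k', hk', -, happ⟩ := hρ.exists_eliminate hk
  refine ⟨k', hk', fun π => ?_⟩
  obtain ⟨g, hg, hπ⟩ := π.exists_exposed hI
  rw [hρ.passed_eliminate_iff hk hk' happ hπ hg, hiff]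
  exact or_congr_left Subtype.ext_iff.symm

/-- Every closed set of rotations is the set of rotations passed by some stable matching. -/
theorem exists_passed_iff_mem (hf : I.IsManOptimalEquiv f) (hI : I.Preprocessed)
    {S : Finset I.Rotation} (hS : I.IsClosedSubset (graph f) S) :
    ∃ g, I.IsStableEquiv g ∧ ∀ ρ : I.Rotation, I.Passed g ρ.1 ↔ ρ ∈ S := by
  classical
  have hunion : ∀ T : Finset I.Rotation, ∃ g, I.IsStableEquiv g ∧ ∀ π : I.Rotation,
      I.Passed g π.1 ↔ ∃ ρ ∈ T, π = ρ ∨ I.Precedes (graph f) π ρ := by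
    intro T
    induction T using Finset.induction_on with
    | empty => exact ⟨f, hf.1, fun π => by simpa using hf.not_passed hI π⟩
    | insert ρ T _ ih =>
      obtain ⟨g, hg, hgiff⟩ := ih
      obtain ⟨k, hk, hkiff⟩ := hf.exists_passed_iff_eq_or_precedes hI ρ
      -- Passing only asks for one man with a worse partner, so the join has passed exactly what
      -- either matching has.
      obtain ⟨c, hc, happ⟩ := hk.exists_sup hg
      refine ⟨c, hc, fun π => ?_⟩
      rw [Finset.exists_mem_insert, ← hkiff, ← hgiff]
      constructor
      · rintro ⟨p, hp, hlt⟩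
        rw [happ] at hlt
        split_ifs at hlt
        exacts [Or.inr ⟨p, hp, hlt⟩, Or.inl ⟨p, hp, hlt⟩]
      · rintro (h | h)
        · refine h.mono fun m => ?_
          rw [happ]
          split_ifs with h <;> omega
        · refine h.mono fun m => ?_
          rw [happ]
          split_ifs with h <;> omega
  obtain ⟨g, hg, hiff⟩ := hunion S
  refine ⟨g, hg, fun π => (hiff π).trans ⟨?_, fun h => ⟨π, h, Or.inl rfl⟩⟩⟩
  rintro ⟨ρ, hρ, rfl | h⟩
  exacts [hρ, hS ρ hρ π h]

theorem existsUnique_obtained (hf : I.IsManOptimalEquiv f) (hI : I.Preprocessed)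
    {S : Finset I.Rotation} (hS : I.IsClosedSubset (graph f) S) :
    ∃! M, I.ObtainedByEliminating (graph f) S M := by
  obtain ⟨g, hg, hiff⟩ := hf.exists_passed_iff_mem hI hS
  have h := hf.obtained_of_passed_iff hI hg hiff
  exact ⟨graph g, h, fun M hM => hM.unique hf.1 h⟩

theorem isStable_of_obtained (hf : I.IsManOptimalEquiv f) (hI : I.Preprocessed)
    {S : Finset I.Rotation} {M : Finset (U × W)} (h : I.ObtainedByEliminating (graph f) S M) :
    I.IsStable M := by
  obtain ⟨L, -, -, hL⟩ := h
  obtain ⟨g, hg, rfl, -⟩ := hL.spec hI hf.1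
  exact isStable_graph.2 hg

theorem exists_closed_obtained (hf : I.IsManOptimalEquiv f) (hI : I.Preprocessed)
    {M : Finset (U × W)} (hM : I.IsStable M) :
    ∃ S, I.IsClosedSubset (graph f) S ∧ I.ObtainedByEliminating (graph f) S M := by
  obtain ⟨g, rfl⟩ := exists_eq_graph hI hM
  have hg := isStable_graph.1 hM
  have hiff : ∀ ρ : I.Rotation, I.Passed g ρ.1 ↔
      ρ ∈ (Set.toFinite {ρ : I.Rotation | I.Passed g ρ.1}).toFinset := by
    intro ρ
    simp
  exact ⟨_, hf.isClosedSubset_of_passed_iff hI hg hiff, hf.obtained_of_passed_iff hI hg hiff⟩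

end IsManOptimalEquiv

/-! ### Optimal closed sets and optimal matchings -/

theorem exists_closed_max {A : Type*} [LinearOrder A] (M₀ : Finset (U × W))
    (F : Finset I.Rotation → A) :
    ∃ S, I.IsClosedSubset M₀ S ∧ ∀ S', I.IsClosedSubset M₀ S' → F S' ≤ F S := by
  obtain ⟨S, hS, hmax⟩ := Set.exists_max_image {S | I.IsClosedSubset M₀ S} F (Set.toFinite _)
    ⟨∅, fun ρ hρ => absurd hρ (Finset.notMem_empty ρ)⟩
  exact ⟨S, hS, hmax⟩

theorem setRevNegProfile_eq (S : Finset I.Rotation) :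
    I.setRevNegProfile S = -reverse (I.setProfile S) := by
  funext k
  simp [setRevNegProfile, setProfile, reverse]

end SMI

theorem mainTheorem9 {U W : Type*} [Fintype U] [Fintype W] [DecidableEq U] [DecidableEq W]
    (I : SMI U W) (hI : I.Preprocessed) (M₀ : Finset (U × W)) (hM₀ : I.IsManOptimal M₀) :
    ((∃ S, I.IsMaxProfileClosedSubset M₀ S) ∧
      ∀ S, I.IsMaxProfileClosedSubset M₀ S →
        (∃! M, I.ObtainedByEliminating M₀ S M) ∧
        ∀ M, I.ObtainedByEliminating M₀ S M → I.IsRankMaximal M) ∧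
    ((∃ S, I.IsMaxRevNegProfileClosedSubset M₀ S) ∧
      ∀ S, I.IsMaxRevNegProfileClosedSubset M₀ S →
        (∃! M, I.ObtainedByEliminating M₀ S M) ∧
        ∀ M, I.ObtainedByEliminating M₀ S M → I.IsGenerous M) := by
  obtain ⟨f, rfl⟩ := SMI.exists_eq_graph hI hM₀.1
  have hf := hM₀.isManOptimalEquiv
  refine ⟨⟨SMI.exists_closed_max _ _, fun S hS => ⟨hf.existsUnique_obtained hI hS.1,
    fun M hM => ⟨hf.isStable_of_obtained hI hM, fun M' hM' => ?_⟩⟩⟩,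
    ⟨SMI.exists_closed_max _ _, fun S hS => ⟨hf.existsUnique_obtained hI hS.1,
    fun M hM => ⟨hf.isStable_of_obtained hI hM, fun M' hM' => ?_⟩⟩⟩⟩
  · obtain ⟨S', hS', hobt⟩ := hf.exists_closed_obtained hI hM'
    rw [hM.profile_eq hf.1, hobt.profile_eq hf.1, toLex_add, toLex_add]
    exact add_le_add_right (hS.2 S' hS') _
  · obtain ⟨S', hS', hobt⟩ := hf.exists_closed_obtained hI hM'
    have h := hS.2 S' hS'
    rw [SMI.setRevNegProfile_eq, SMI.setRevNegProfile_eq, toLex_neg, toLex_neg,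
      neg_le_neg_iff] at h
    rw [hM.profile_eq hf.1, hobt.profile_eq hf.1]
    -- `reverse` is additive by definition, so the reversed profile of `M₀` splits off as a common
    -- summand.
    exact add_le_add_right h (toLex (SMI.reverse (I.profile (SMI.graph f))))
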